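/- Let $n\ge 1$ and $h$ be integers, and let $0<\varepsilon<1$, $\delta\ge 0$, $0<\beta\le\tfrac12$ and $\hat\tau\in\mathbb R$. Let $\mathcal T$ be the complete binary tree of height $h>6+\log_2(n^2/\beta^{15})$, where the height is the number of nodes on a root-to-leaf path (so $\mathcal T$ has $2^{h-1}$ leaves). Let $\mathcal X$ be a data domain in which each record contributes to exactly one leaf of $\mathcal T$, and assume that each leaf is the leaf of some record. For a dataset $D\in\mathcal X^*$, the count of a node of $\mathcal T$ is the number of records in $D$ whose leaf lies in the subtree rooted at that node. Let $\mathcal M$ be a randomized mechanism that maps each dataset $D\in\mathcal X^*$ to a random set of nodes of $\mathcal T$, and assume that 1. $\mathcal M$ is $(\varepsilon,\delta)$-differentially private: $\Pr[\mathcal M(D)\in Z]\le e^{\varepsilon}\Pr[\mathcal M(D')\in Z]+\delta$ for every set $Z$ of outputs and all datasets $D,D'$ one of which arises from the other by adding a single record; 2. on every dataset of size $n$, $\mathcal M$ outputs at most $n^2$ nodes in each layer of $\mathcal T$; 3. on every dataset of size $n$, with probability at least $1-\beta$ the output of $\mathcal M$ contains all nodes of $\mathcal T$ with count greater than $\hat\tau$.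 Then $$\hat\tau\ \ge\ \frac12\cdot\min\left(\frac1{8\varepsilon}\ln\left(\frac{2^{h-1}}{32\beta n^2}\right)-1,\ \ \frac1{4\varepsilon}\ln\left(\frac{\varepsilon}{4\delta}\right)-1,\ \ n\right),$$ where for $\delta=0$ the second term in the minimum is $+\infty$. -/

import Mathlib

namespace HeavyHitters

/-- `D'` arises from the dataset `D` by adding one record (at any position). -/
def AddsRecord {X : Type*} (D D' : List X) : Prop :=
  ∃ (l₁ l₂ : List X) (x : X), D = l₁ ++ l₂ ∧ D' = l₁ ++ x :: l₂

/-- Add/remove neighbours: one dataset arises from the other by adding one record. -/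
def Neighbors {X : Type*} (D D' : List X) : Prop :=
  AddsRecord D D' ∨ AddsRecord D' D

/-- The probability of the event `Z` under the discrete distribution `p`. -/
noncomputable def prob {α : Type*} (p : PMF α) (Z : Set α) : ℝ :=
  (p.toOuterMeasure Z).toReal

/-- `(ε, δ)`-differential privacy, for the add/remove neighbouring relation, of a randomized
mechanism on datasets of arbitrary size with a discrete output space. -/
def IsDP {X α : Type*} (ε δ : ℝ) (M : List X → PMF α) : Prop :=
  ∀ D D' : List X, Neighbors D D' → ∀ Z : Set α,
    prob (M D) Z ≤ Real.exp ε * prob (M D') Z + δ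

/-- The nodes of the complete binary tree of height `h`. A node is the sequence of left/right
turns on the way from the root to it; the height counts the nodes on a root-to-leaf path, so the
turn sequences of length `0, …, h - 1` occur. -/
abbrev Node (h : ℕ) : Type := {u : List Bool // u.length < h}

/-- The layer of a node; the root is in layer `0`. -/
def Node.layer {h : ℕ} (u : Node h) : ℕ := u.1.length

/-- The leaves of the complete binary tree of height `h`: the nodes in the last layer. -/
abbrev Leaf (h : ℕ) : Type := {u : Node h // u.layer + 1 = h}

/-- The count of the node `u`: the number of records of `D` whose leaf lies in the subtree rooted
at `u`, where `leafOf` says to which leaf a record contributes. -/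
def count {X : Type*} {h : ℕ} (leafOf : X → Leaf h) (D : List X) (u : Node h) : ℕ :=
  D.countP fun x => decide (u.1 <+: (leafOf x).1.1)

/-- On every dataset of size `n`, the mechanism never outputs more than `m` nodes of one layer. -/
def AtMostPerLayer {X : Type*} {h : ℕ} (n m : ℕ) (M : List X → PMF (Finset (Node h))) : Prop :=
  ∀ D : List X, D.length = n → ∀ S ∈ (M D).support, ∀ ℓ : ℕ,
    (S.filter fun u => u.layer = ℓ).card ≤ m

/-- On every dataset of size `n`, with probability at least `1 - β` the mechanism outputs all
nodes with count above `τ`. -/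
def FindsHeavy {X : Type*} {h : ℕ} (leafOf : X → Leaf h) (n : ℕ) (β τ : ℝ)
    (M : List X → PMF (Finset (Node h))) : Prop :=
  ∀ D : List X, D.length = n →
    1 - β ≤ prob (M D) {S | ∀ u : Node h, τ < (count leafOf D u : ℝ) → u ∈ S}

end HeavyHitters

/-!
The proof is a packing argument. Fix a record `x₀` and let `D₀` consist of `n` copies of it. The
mechanism outputs at most `n ^ 2` leaves on `D₀`, so by averaging some leaf `v` among the
`2 ^ (h - 1)` is output with probability at most `n ^ 2 / 2 ^ (h - 1)` (`exists_prob_mem_le`).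
Replacing `t` copies of `x₀` by a record at `v` makes the count of `v` exceed `τ` as soon as
`τ < t`, so `v` must then be output with probability at least `1 - β`. The two datasets are `2 t`
neighbouring steps apart, and group privacy (`IsDP.prob_le_of_chain`) yields

  `1 - β ≤ e ^ (2 t ε) * n ^ 2 / 2 ^ (h - 1) + δ * ∑ i < 2 t, e ^ (i ε)`

(`one_sub_le_of_lt`). For `t = 0` this is absurd, whence `0 ≤ τ`. For `t = ⌊τ⌋ + 1` one of the two
summands is at least `1 / 4`, and taking logarithms bounds `τ` from below, by `tau_ge_of_size` or by
`tau_ge_of_delta`. The factor `1 / β` in the logarithm of the claim costs nothing: by the assumption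
on the height, `1 / β` is at most the fifteenth root of `2 ^ (h - 6) / n ^ 2`.
-/

namespace HeavyHitters

open Finset

/-! ### Probabilities under discrete distributions -/

lemma toOuterMeasure_ne_top {α : Type*} (p : PMF α) (Z : Set α) : p.toOuterMeasure Z ≠ ⊤ :=
  ne_top_of_le_ne_top ENNReal.one_ne_top <|
    (p.toOuterMeasure_apply_eq_one_iff Set.univ).2 (Set.subset_univ _) ▸
      p.toOuterMeasure.mono (Set.subset_univ Z)

lemma prob_mono {α : Type*} (p : PMF α) {Y Z : Set α} (hYZ : Y ⊆ Z) : prob p Y ≤ prob p Z :=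
  ENNReal.toReal_mono (toOuterMeasure_ne_top p Z) (p.toOuterMeasure.mono hYZ)

/-- If a random finite set almost surely contains at most `m` of the elements `f i`, then the
probabilities that `f i` belongs to it sum to at most `m`. -/
lemma sum_prob_mem_le {α ι : Type*} [DecidableEq α] [Fintype ι] (p : PMF (Finset α)) (f : ι → α)
    (m : ℕ) (hm : ∀ S ∈ p.support, (univ.filter fun i => f i ∈ S).card ≤ m) :
    ∑ i, prob p {S | f i ∈ S} ≤ m := by
  unfold prob
  rw [← ENNReal.toReal_sum fun i _ => toOuterMeasure_ne_top p _]
  refine ENNReal.toReal_le_of_le_ofReal (Nat.cast_nonneg m) ?_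
  rw [ENNReal.ofReal_natCast]
  simp_rw [PMF.toOuterMeasure_apply]
  rw [← Summable.tsum_finsetSum fun i _ => ENNReal.summable]
  calc ∑' S, ∑ i, Set.indicator {S : Finset α | f i ∈ S} p S
      ≤ ∑' S, p S * m := by
        refine ENNReal.tsum_le_tsum fun S => ?_
        by_cases hS : S ∈ p.support
        · have : ∑ i, Set.indicator {S : Finset α | f i ∈ S} p S
              = p S * ((univ.filter fun i => f i ∈ S).card : ENNReal) := by
            simp only [Set.indicator_apply, Set.mem_ofPred_eq]
            rw [← Finset.sum_filter, Finset.sum_const, nsmul_eq_mul, mul_comm]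
          rw [this]
          gcongr
          exact hm S hS
        · have : p S = 0 := by simpa [PMF.mem_support_iff] using hS
          simp [Set.indicator_apply, this]
    _ = m := by rw [ENNReal.tsum_mul_right, p.tsum_coe, one_mul]

/-! ### Group privacy -/

lemma IsDP.prob_le_of_chain {X α : Type*} {ε δ : ℝ} {M : List X → PMF α} (hDP : IsDP ε δ M)
    (D : ℕ → List X) (Z : Set α) (k : ℕ) (hD : ∀ i < k, Neighbors (D i) (D (i + 1))) :
    prob (M (D 0)) Z ≤
      Real.exp (k * ε) * prob (M (D k)) Z + δ * ∑ i ∈ range k, Real.exp (i * ε) := by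
  induction k with
  | zero => simp
  | succ k ih =>
    have h₁ := ih fun i hi => hD i (by omega)
    have h₂ := hDP _ _ (hD k (by omega)) Z
    have h₃ := mul_le_mul_of_nonneg_left h₂ (Real.exp_pos (k * ε)).le
    have h₄ : Real.exp (((k + 1 : ℕ) : ℝ) * ε) = Real.exp (k * ε) * Real.exp ε := by
      rw [← Real.exp_add]; push_cast; ring_nf
    rw [sum_range_succ, h₄]
    linarith

/-- Replacing `t` copies of one record by `t` copies of another takes `2 * t` neighbouring steps:
`t` removals followed by `t` insertions. -/
lemma IsDP.prob_replicate_le {X α : Type*} {ε δ : ℝ} {M : List X → PMF α} (hDP : IsDP ε δ M)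
    (x y : X) {n t : ℕ} (ht : t ≤ n) (Z : Set α) :
    prob (M (List.replicate t x ++ List.replicate (n - t) y)) Z ≤
      Real.exp ((2 * t : ℕ) * ε) * prob (M (List.replicate n y)) Z +
        δ * ∑ i ∈ range (2 * t), Real.exp (i * ε) := by
  -- Truncated subtraction makes the removals end, and the insertions begin, at step `t`.
  have key := hDP.prob_le_of_chain (fun i => List.replicate (t - i) x ++
    (List.replicate (i - t) y ++ List.replicate (n - t) y)) Z (2 * t) ?_
  · have h₁ : t - 2 * t = 0 := by omega
    have h₂ : 2 * t - t + (n - t) = n := by omega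
    simpa [h₁, h₂, List.replicate_append_replicate] using key
  · intro i _
    rcases lt_or_ge i t with hi | hi
    · right
      refine ⟨[], _, x, rfl, ?_⟩
      have h₁ : t - i = t - (i + 1) + 1 := by omega
      have h₂ : i - t = 0 := by omega
      have h₃ : i + 1 - t = 0 := by omega
      simp [h₁, h₂, h₃, List.replicate_succ]
    · left
      refine ⟨[], _, y, rfl, ?_⟩
      have h₁ : t - i = 0 := by omega
      have h₂ : t - (i + 1) = 0 := by omega
      have h₃ : i + 1 - t = i - t + 1 := by omega
      simp [h₁, h₂, h₃, List.replicate_succ]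

lemma sum_exp_le {ε : ℝ} (hε : 0 < ε) (k : ℕ) :
    ∑ i ∈ range k, Real.exp (i * ε) ≤ Real.exp (k * ε) / ε := by
  have h₁ : ε ≤ Real.exp ε - 1 := by linarith [Real.add_one_le_exp ε]
  have h₂ : (∑ i ∈ range k, Real.exp (i * ε)) * (Real.exp ε - 1) = Real.exp (k * ε) - 1 := by
    simp_rw [Real.exp_nat_mul]
    exact geom_sum_mul _ _
  rw [le_div_iff₀ hε]
  have h₃ : 0 ≤ ∑ i ∈ range k, Real.exp (i * ε) := sum_nonneg fun i _ => (Real.exp_pos _).le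
  nlinarith [mul_le_mul_of_nonneg_left h₁ h₃]

/-! ### The packing argument -/

/-- The leaf reached from the root by the turns `w`. -/
def leafNode {h : ℕ} (hh : 0 < h) (w : Fin (h - 1) → Bool) : Node h :=
  ⟨List.ofFn w, by simp; omega⟩

lemma leafNode_layer {h : ℕ} (hh : 0 < h) (w : Fin (h - 1) → Bool) :
    (leafNode hh w).layer = h - 1 := by
  simp [leafNode, Node.layer]

lemma leafNode_injective {h : ℕ} (hh : 0 < h) :
    Function.Injective (leafNode hh) := fun _ _ hvw =>
  List.ofFn_injective (congrArg Subtype.val hvw)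

/-- A mechanism with at most `m` outputs per layer misses most leaves: some leaf is output with
probability at most `m / 2 ^ (h - 1)`. -/
lemma exists_prob_mem_le {X : Type*} {h n m : ℕ} (hh : 0 < h)
    {M : List X → PMF (Finset (Node h))} (hsize : AtMostPerLayer n m M)
    {D : List X} (hD : D.length = n) :
    ∃ v : Leaf h, prob (M D) {S | v.1 ∈ S} ≤ m / 2 ^ (h - 1) := by
  classical
  have hsum := sum_prob_mem_le (M D) (leafNode hh) m fun S hS => by
    refine le_trans ?_ (hsize D hD S hS (h - 1))
    refine card_le_card_of_injOn (leafNode hh) (fun w hw => ?_) (leafNode_injective hh).injOn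
    simpa [leafNode_layer] using hw
  obtain ⟨w, -, hw⟩ := exists_le_of_sum_le (s := univ)
    (f := fun w => prob (M D) {S | leafNode hh w ∈ S})
    (g := fun _ => (m : ℝ) / 2 ^ (h - 1)) univ_nonempty (by
      refine hsum.trans_eq ?_
      rw [sum_const, nsmul_eq_mul, card_univ, Fintype.card_fun, Fintype.card_bool,
        Fintype.card_fin]
      push_cast
      field_simp)
  exact ⟨⟨leafNode hh w, by rw [leafNode_layer]; omega⟩, hw⟩

lemma le_count_replicate_append {X : Type*} {h : ℕ} (leafOf : X → Leaf h) (x : X) (t : ℕ)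
    (D : List X) : t ≤ count leafOf (List.replicate t x ++ D) (leafOf x).1 := by
  simp [count, List.countP_replicate]

/-- The inequality of the packing argument, for `t` copies of a record at an unlikely leaf. -/
lemma one_sub_le_of_lt {X : Type*} {n m h t : ℕ} {ε δ β τ : ℝ} (hh : 0 < h)
    {leafOf : X → Leaf h} (hleaf : Function.Surjective leafOf)
    {M : List X → PMF (Finset (Node h))} (hDP : IsDP ε δ M) (hsize : AtMostPerLayer n m M)
    (hheavy : FindsHeavy leafOf n β τ M) (ht : t ≤ n) (hτ : τ < t) :
    1 - β ≤ Real.exp ((2 * t : ℕ) * ε) * (m / 2 ^ (h - 1)) +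
      δ * ∑ i ∈ range (2 * t), Real.exp (i * ε) := by
  obtain ⟨y, -⟩ := hleaf ⟨leafNode hh fun _ => false, by rw [leafNode_layer]; omega⟩
  obtain ⟨v, hv⟩ := exists_prob_mem_le hh hsize (List.length_replicate (n := n) (a := y))
  obtain ⟨x, rfl⟩ := hleaf v
  calc 1 - β
      ≤ _ := hheavy (List.replicate t x ++ List.replicate (n - t) y) (by simp; omega)
    _ ≤ prob (M (List.replicate t x ++ List.replicate (n - t) y)) {S | (leafOf x).1 ∈ S} :=
        prob_mono _ fun S hS => hS _ <| hτ.trans_le <|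
          Nat.cast_le.2 (le_count_replicate_append leafOf x t _)
    _ ≤ _ := hDP.prob_replicate_le x y ht _
    _ ≤ _ := by gcongr

/-! ### Solving for the threshold -/

/-- The assumption on the height, without logarithms. -/
lemma inv_pow_lt_of_height {n h : ℕ} {β : ℝ} (hn : 1 ≤ n) (hβ : 0 < β)
    (hh : 6 + Real.logb 2 ((n : ℝ) ^ 2 / β ^ 15) < (h : ℝ)) :
    (1 / β) ^ 15 < 2 ^ (h - 1) / (32 * (n : ℝ) ^ 2) := by
  have hn' : (0 : ℝ) < n := by exact_mod_cast hn
  have hq : 0 < (n : ℝ) ^ 2 / β ^ 15 := by positivity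
  have h₁ : (n : ℝ) ^ 2 / β ^ 15 < 2 ^ ((h : ℝ) - 6) :=
    (Real.logb_lt_iff_lt_rpow one_lt_two hq).1 (by linarith)
  have h₂ : (2 : ℝ) ^ ((h : ℝ) - 6) ≤ 2 ^ (h - 1) / 32 := by
    have h₃ : (h : ℝ) ≤ (h - 1 : ℕ) + 1 := by exact_mod_cast (by omega : h ≤ h - 1 + 1)
    calc (2 : ℝ) ^ ((h : ℝ) - 6) ≤ 2 ^ (((h - 1 : ℕ) : ℝ) - (5 : ℕ)) :=
          Real.rpow_le_rpow_of_exponent_le one_le_two (by push_cast; linarith)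
      _ = 2 ^ (h - 1) / 32 := by
          rw [Real.rpow_sub two_pos, Real.rpow_natCast, Real.rpow_natCast]; norm_num
  have h₄ := h₁.trans_le h₂
  rw [one_div, inv_pow, lt_div_iff₀ (by positivity)]
  calc (β ^ 15)⁻¹ * (32 * (n : ℝ) ^ 2) = (n : ℝ) ^ 2 / β ^ 15 * 32 := by
        rw [div_eq_mul_inv]; ring
    _ < 2 ^ (h - 1) := by linarith

/-- The slack between the exponents `s * ε ≤ 2 * (τ + 1) * ε` and the `1 / (16 * ε)` of the claim pays
for the summand `log (1 / β)`, which is at most a fifteenth of the main term. -/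
lemma tau_ge_of_size {n h : ℕ} {ε β τ s : ℝ} (hn : 1 ≤ n) (hε0 : 0 < ε) (hε1 : ε < 1)
    (hβ0 : 0 < β) (hβ1 : β ≤ 1 / 2)
    (hh : (1 / β) ^ 15 < 2 ^ (h - 1) / (32 * (n : ℝ) ^ 2)) (hs : s ≤ 2 * (τ + 1))
    (hexp : 1 / 4 ≤ Real.exp (s * ε) * ((n : ℝ) ^ 2 / 2 ^ (h - 1))) :
    1 / 2 * (1 / (8 * ε) * Real.log ((2 : ℝ) ^ (h - 1) / (32 * β * (n : ℝ) ^ 2)) - 1) ≤ τ := by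
  have hn' : (0 : ℝ) < n := by exact_mod_cast hn
  set L : ℝ := 2 ^ (h - 1) / (32 * (n : ℝ) ^ 2) with hL
  have hL0 : 0 < L := by positivity
  have hβlog : 15 * Real.log (1 / β) ≤ Real.log L := by
    have := Real.log_le_log (by positivity) hh.le
    rwa [Real.log_pow] at this
  have hβpos : 0 ≤ Real.log (1 / β) :=
    Real.log_nonneg ((one_le_div hβ0).2 (by linarith))
  have hsplit : Real.log ((2 : ℝ) ^ (h - 1) / (32 * β * (n : ℝ) ^ 2)) =
      Real.log L + Real.log (1 / β) := by
    rw [← Real.log_mul hL0.ne' (by positivity)]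
    congr 1
    rw [hL]; field_simp
  have hexp' : 8 * L ≤ Real.exp (s * ε) := by
    have : 1 / 4 * (2 ^ (h - 1) / (n : ℝ) ^ 2) ≤ Real.exp (s * ε) := by
      calc _ ≤ Real.exp (s * ε) * ((n : ℝ) ^ 2 / 2 ^ (h - 1)) * (2 ^ (h - 1) / (n : ℝ) ^ 2) := by
            gcongr
        _ = _ := by field_simp
    calc 8 * L = 1 / 4 * (2 ^ (h - 1) / (n : ℝ) ^ 2) := by rw [hL]; field_simp; norm_num
      _ ≤ _ := this
  have hlog8 : 1 ≤ Real.log 8 := by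
    rw [Real.le_log_iff_exp_le (by norm_num)]
    linarith [Real.exp_one_lt_d9]
  have hmain : 1 + Real.log L ≤ s * ε := by
    have := (Real.log_le_iff_le_exp (by positivity)).2 hexp'
    rw [Real.log_mul (by norm_num) hL0.ne'] at this
    linarith
  have hsε : s * ε ≤ 2 * (τ + 1) * ε := by gcongr
  rw [hsplit]
  have hgoal : 1 / 2 * (1 / (8 * ε) * (Real.log L + Real.log (1 / β)) - 1) =
      ((Real.log L + Real.log (1 / β)) / 16 - ε / 2) / ε := by field_simp; ring
  rw [hgoal, div_le_iff₀ hε0]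
  linarith

lemma tau_ge_of_delta {ε δ τ s : ℝ} (hε0 : 0 < ε) (hδ : 0 < δ) (hτ : 0 ≤ τ)
    (hs : s ≤ 2 * (τ + 1)) (hexp : 1 / 4 ≤ δ * (Real.exp (s * ε) / ε)) :
    1 / 2 * (1 / (4 * ε) * Real.log (ε / (4 * δ)) - 1) ≤ τ := by
  have hlog : Real.log (ε / (4 * δ)) ≤ s * ε := by
    rw [Real.log_le_iff_le_exp (by positivity), div_le_iff₀ (by positivity)]
    have := mul_le_mul_of_nonneg_right hexp hε0.le
    rw [mul_assoc, div_mul_cancel₀ _ hε0.ne'] at this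
    linarith
  have hsε : s * ε ≤ 2 * (τ + 1) * ε := by gcongr
  have hgoal : 1 / 2 * (1 / (4 * ε) * Real.log (ε / (4 * δ)) - 1) =
      (Real.log (ε / (4 * δ)) / 8 - ε / 2) / ε := by field_simp; ring
  rw [hgoal, div_le_iff₀ hε0]
  nlinarith [mul_nonneg hτ hε0.le]

end HeavyHitters

open HeavyHitters in
theorem mainTheorem3 {X : Type*} (n h : ℕ) (ε δ β τ : ℝ)
    (hn : 1 ≤ n) (hε0 : 0 < ε) (hε1 : ε < 1) (hδ : 0 ≤ δ) (hβ0 : 0 < β) (hβ1 : β ≤ 1 / 2)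
    (hh : 6 + Real.logb 2 ((n : ℝ) ^ 2 / β ^ 15) < (h : ℝ))
    (leafOf : X → HeavyHitters.Leaf h) (hleaf : Function.Surjective leafOf)
    (M : List X → PMF (Finset (HeavyHitters.Node h)))
    (hDP : HeavyHitters.IsDP ε δ M)
    (hsize : HeavyHitters.AtMostPerLayer n (n ^ 2) M)
    (hheavy : HeavyHitters.FindsHeavy leafOf n β τ M) :
    (0 < δ →
      τ ≥ 1 / 2 * min (min
        (1 / (8 * ε) * Real.log ((2 : ℝ) ^ (h - 1) / (32 * β * (n : ℝ) ^ 2)) - 1)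
        (1 / (4 * ε) * Real.log (ε / (4 * δ)) - 1))
        (n : ℝ)) ∧
    -- for `δ = 0` the logarithm of `ε / (4 * δ)` means infinity, and its term drops out
    (δ = 0 →
      τ ≥ 1 / 2 * min
        (1 / (8 * ε) * Real.log ((2 : ℝ) ^ (h - 1) / (32 * β * (n : ℝ) ^ 2)) - 1)
        (n : ℝ)) := by
  have hn' : (0 : ℝ) < n := by exact_mod_cast hn
  have hheight := inv_pow_lt_of_height hn hβ0 hh
  have h1 : 1 ≤ (1 / β) ^ 15 := one_le_pow₀ ((one_le_div hβ0).2 (by linarith))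
  have hpow : 32 * (n : ℝ) ^ 2 < 2 ^ (h - 1) := by
    have := h1.trans_lt hheight
    rwa [one_lt_div (by positivity)] at this
  have hpos : 0 < h := by
    rcases Nat.eq_zero_or_pos h with rfl | hp
    · have : (1 : ℝ) ≤ (n : ℝ) ^ 2 := one_le_pow₀ (by exact_mod_cast hn)
      norm_num at hpow
      linarith
    · exact hp
  -- For `τ < 0` every leaf counts as heavy, on every dataset.
  have hτ0 : 0 ≤ τ := by
    by_contra! hτ
    have key := one_sub_le_of_lt hpos hleaf hDP hsize hheavy (Nat.zero_le n) (by simpa using hτ)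
    have : (n : ℝ) ^ 2 / 2 ^ (h - 1) < 1 / 32 := by
      rw [div_lt_iff₀ (by positivity)]; linarith
    simp only [mul_zero, Finset.range_zero, Finset.sum_empty, Nat.cast_zero, zero_mul,
      Real.exp_zero, one_mul, add_zero, Nat.cast_pow] at key
    linarith
  -- If `τ < n / 2`, then `⌊τ⌋ + 1` copies of a record fit into a dataset of size `n`.
  have hdich : τ < 1 / 2 * n → ∃ s ≤ 2 * (τ + 1),
      1 / 2 ≤ Real.exp (s * ε) * ((n : ℝ) ^ 2 / 2 ^ (h - 1)) + δ * (Real.exp (s * ε) / ε) := by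
    intro hτn
    have hfl := Nat.floor_le hτ0
    have ht : ⌊τ⌋₊ + 1 ≤ n := by
      have : (⌊τ⌋₊ : ℝ) < n := by linarith
      exact_mod_cast this
    have key := one_sub_le_of_lt hpos hleaf hDP hsize hheavy ht
      (by exact_mod_cast Nat.lt_floor_add_one τ)
    refine ⟨((2 * (⌊τ⌋₊ + 1) : ℕ) : ℝ), by push_cast; linarith, ?_⟩
    have hsum := mul_le_mul_of_nonneg_left (sum_exp_le hε0 (2 * (⌊τ⌋₊ + 1))) hδ
    rw [Nat.cast_pow] at key
    linarith
  constructor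
  · intro hδ0
    by_contra! hlt
    have hA : τ < 1 / 2 *
        (1 / (8 * ε) * Real.log ((2 : ℝ) ^ (h - 1) / (32 * β * (n : ℝ) ^ 2)) - 1) :=
      hlt.trans_le (by gcongr; exact (min_le_left _ _).trans (min_le_left _ _))
    have hB : τ < 1 / 2 * (1 / (4 * ε) * Real.log (ε / (4 * δ)) - 1) :=
      hlt.trans_le (by gcongr; exact (min_le_left _ _).trans (min_le_right _ _))
    obtain ⟨s, hs, hsum⟩ := hdich (hlt.trans_le (by gcongr; exact min_le_right _ _))
    rcases le_or_gt (1 / 4) (Real.exp (s * ε) * ((n : ℝ) ^ 2 / 2 ^ (h - 1))) with hc | hc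
    · exact hA.not_ge (tau_ge_of_size hn hε0 hε1 hβ0 hβ1 hheight hs hc)
    · exact hB.not_ge (tau_ge_of_delta hε0 hδ0 hτ0 hs (by linarith))
  · rintro rfl
    by_contra! hlt
    have hA : τ < 1 / 2 *
        (1 / (8 * ε) * Real.log ((2 : ℝ) ^ (h - 1) / (32 * β * (n : ℝ) ^ 2)) - 1) :=
      hlt.trans_le (by gcongr; exact min_le_left _ _)
    obtain ⟨s, hs, hsum⟩ := hdich (hlt.trans_le (by gcongr; exact min_le_right _ _))
    exact hA.not_ge (tau_ge_of_size hn hε0 hε1 hβ0 hβ1 hheight hs (by linarith))
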